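/- Let $X, X_1, X_2, \dots$ be real random variables on a probability space such that $X_1, X_2, \dots$ are independent with the same law as $X$. Let $EX^2<\infty$, and write $\mu=EX$ and $F$ for the distribution function of $X$. For $\tau\in(0,1)$ let $\ell_\tau(x)=\tau x^2$ if $x\ge 0$ and $\ell_\tau(x)=(1-\tau)x^2$ if $x<0$, and let $e_X(\tau)$ be the $\tau$-expectile of $X$, i.e. the unique minimizer of $t\mapsto E[\ell_\tau(X-t)-\ell_\tau(X)]$, $t\in\mathbb R$. Put $$I_\tau(x,y)=\tau (y-x)\mathbf 1_{\{y\ge x\}}-(1-\tau)(x-y)\mathbf 1_{\{y<x\}},$$ and let the empirical expectile $\hat e_n(\tau)$ be the unique solution $t$ of $\frac1n\sum_{i=1}^n I_\tau(t,X_i)=0$. With $\bar X_n=\frac1n\sum_{i=1}^n X_i$ define, for $\alpha\in(0,1/2)$, $$s_2(\alpha)=\frac{1}{1-2\alpha}\,\frac{e_X(1-\alpha)+e_X(\alpha)-2\mu}{e_X(1-\alpha)-e_X(\alpha)},\qquad \hat s_{2,n}(\alpha)=\frac{1}{1-2\alpha}\,\frac{\hat e_n(1-\alpha)+\hat e_n(\alpha)-2\bar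 X_n}{\hat e_n(1-\alpha)-\hat e_n(\alpha)},$$ where $\hat s_{2,n}(\alpha)$ is given the value $0$ if its denominator vanishes. Further let $$\eta(\tau_1,\tau_2)=E\big[I_{\tau_1}(e_X(\tau_1),X)\,I_{\tau_2}(e_X(\tau_2),X)\big],\qquad A(\tau)=(2\cdot\mathbf 1_{\{\tau<1/2\}}-1)\,\frac{e_X(1-\tau)-\mu}{\tau+F(e_X(\tau))(1-2\tau)} .$$ **Theorem.** Let $\alpha\in(0,1/2)$ and suppose that $F$ has no point mass at $e_X(p)$ for $p\in\{\alpha,1/2,1-\alpha\}$. Put $$\begin{aligned}\sigma_\alpha^2=\frac{4}{(1-2\alpha)^2}\bigg[&\frac{4\,\eta(1/2,1/2)}{(e_X(1-\alpha)-e_X(\alpha))^2}-\frac{4\,[A(\alpha)\eta(\alpha,1/2)+A(1-\alpha)\eta(1/2,1-\alpha)]}{(e_X(1-\alpha)-e_X(\alpha))^3}\\&+\frac{A(\alpha)^2\eta(\alpha,\alpha)+2A(\alpha)A(1-\alpha)\eta(\alpha,1-\alpha)+A(1-\alpha)^2\eta(1-\alpha,1-\alpha)}{(e_X(1-\alpha)-e_X(\alpha))^4}\bigg].\end{aligned}$$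 Then $\sigma_\alpha^2\ge 0$ and $$\sqrt n\,\big(\hat s_{2,n}(\alpha)-s_2(\alpha)\big)\ \xrightarrow{\ \mathcal D\ }\ N(0,\sigma_\alpha^2)\qquad(n\to\infty),$$ where $N(0,0)$ denotes the point mass at $0$. -/

import Mathlib

open MeasureTheory ProbabilityTheory Filter Topology

namespace ExpectileSkewness

noncomputable section

/-- The asymmetric quadratic loss `ℓ_α`. -/
def loss (α x : ℝ) : ℝ := if 0 ≤ x then α * x ^ 2 else (1 - α) * x ^ 2

/-- The identification function `I_α(x, y)` of the `α`-expectile. -/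
def ident (α x y : ℝ) : ℝ := if x ≤ y then α * (y - x) else -((1 - α) * (x - y))

section Population

variable {Ω : Type*} [MeasurableSpace Ω] (P : Measure Ω) (X : Ω → ℝ)

/-- `t` minimizes the expected loss `s ↦ E[ℓ_α(X - s) - ℓ_α(X)]`. -/
def IsExpectile (α t : ℝ) : Prop :=
  ∀ s : ℝ, ∫ ω, (loss α (X ω - t) - loss α (X ω)) ∂P ≤ ∫ ω, (loss α (X ω - s) - loss α (X ω)) ∂P

/-- The expectile `e_X(α)`, i.e. the minimizer of `s ↦ E[ℓ_α(X - s) - ℓ_α(X)]`. It exists and is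
unique for integrable `X` and `0 < α < 1`, see `existsUnique_isExpectile`. -/
def expectile (α : ℝ) : ℝ := Classical.epsilon (IsExpectile P X α)

/-- The expectile skewness `s₂(α)`. -/
def skew (α : ℝ) : ℝ :=
  1 / (1 - 2 * α) *
    ((expectile P X (1 - α) + expectile P X α - 2 * ∫ ω, X ω ∂P) /
      (expectile P X (1 - α) - expectile P X α))

/-- `η(τ₁, τ₂) = E[I_{τ₁}(e_X(τ₁), X) I_{τ₂}(e_X(τ₂), X)]`. -/
def eta (τ₁ τ₂ : ℝ) : ℝ :=
  ∫ ω, ident τ₁ (expectile P X τ₁) (X ω) * ident τ₂ (expectile P X τ₂) (X ω) ∂P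

/-- `A(τ)`, where `cdf (P.map X)` is the distribution function `F` of `X`. -/
def coefA (τ : ℝ) : ℝ :=
  (2 * (if τ < 1 / 2 then 1 else 0) - 1) *
    ((expectile P X (1 - τ) - ∫ ω, X ω ∂P) /
      (τ + cdf (P.map X) (expectile P X τ) * (1 - 2 * τ)))

/-- The asymptotic variance `σ_α²`. -/
def asympVar (α : ℝ) : ℝ :=
  4 / (1 - 2 * α) ^ 2 *
    (4 * eta P X (1 / 2) (1 / 2) / (expectile P X (1 - α) - expectile P X α) ^ 2
      - 4 * (coefA P X α * eta P X α (1 / 2) + coefA P X (1 - α) * eta P X (1 / 2) (1 - α)) /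
          (expectile P X (1 - α) - expectile P X α) ^ 3
      + (coefA P X α ^ 2 * eta P X α α
          + 2 * coefA P X α * coefA P X (1 - α) * eta P X α (1 - α)
          + coefA P X (1 - α) ^ 2 * eta P X (1 - α) (1 - α)) /
          (expectile P X (1 - α) - expectile P X α) ^ 4)

end Population

section Sample

variable {n : ℕ} (x : Fin n → ℝ)

/-- The empirical expectile `ê_n(α)` of the sample `x`: the solution `t` of
`(1/n) ∑ I_α(t, x_i) = 0`. It exists and is unique for `n ≥ 1` and `0 < α < 1`, see
`existsUnique_empExpectile`. -/
def empExpectile (α : ℝ) : ℝ :=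
  Classical.epsilon fun t : ℝ => 1 / (n : ℝ) * ∑ i, ident α t (x i) = 0

/-- The empirical expectile skewness `ŝ_{2,n}(α)` of the sample `x`. -/
def empSkew (α : ℝ) : ℝ :=
  1 / (1 - 2 * α) *
    ((empExpectile x (1 - α) + empExpectile x α - 2 * (1 / (n : ℝ) * ∑ i, x i)) /
      (empExpectile x (1 - α) - empExpectile x α))

end Sample

/-! Well-definedness of the expectiles. -/

theorem ident_sub_le {α : ℝ} (h0 : 0 < α) (h1 : α < 1) {s t : ℝ} (h : s ≤ t) (y : ℝ) :
    ident α s y - ident α t y ≤ t - s := by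
  unfold ident
  split_ifs <;> nlinarith

theorem le_ident_sub {α : ℝ} (h0 : 0 < α) (h1 : α < 1) {s t : ℝ} (h : s ≤ t) (y : ℝ) :
    α * (1 - α) * (t - s) ≤ ident α s y - ident α t y := by
  have hα : α * (1 - α) ≤ α := by nlinarith
  have hα' : α * (1 - α) ≤ 1 - α := by nlinarith
  have e1 := mul_le_mul_of_nonneg_right hα (sub_nonneg.2 h)
  have e2 := mul_le_mul_of_nonneg_right hα' (sub_nonneg.2 h)
  unfold ident
  split_ifs with a b b
  · linarith
  · push Not at b
    rcases le_total α (1 - α) with c | c <;> nlinarith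
  · linarith
  · linarith

theorem existsUnique_root {G : ℝ → ℝ} {m : ℝ} (hm : 0 < m)
    (hu : ∀ s t, s ≤ t → G s - G t ≤ t - s) (hl : ∀ s t, s ≤ t → m * (t - s) ≤ G s - G t) :
    ∃! t, G t = 0 := by
  have hc : Continuous G := by
    refine (LipschitzWith.of_dist_le_mul (K := 1) fun s t => ?_).continuous
    rw [Real.dist_eq, Real.dist_eq, NNReal.coe_one, one_mul]
    rcases le_total s t with h | h
    · have := hu s t h
      have h' := hl s t h
      have := mul_nonneg hm.le (sub_nonneg.2 h)
      rw [abs_of_nonneg (by linarith), abs_of_nonpos (by linarith)]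
      linarith
    · have := hu t s h
      have h' := hl t s h
      have := mul_nonneg hm.le (sub_nonneg.2 h)
      rw [abs_of_nonpos (by linarith), abs_of_nonneg (by linarith)]
      linarith
  set r := |G 0| / m with hr
  have hr0 : 0 ≤ r := by positivity
  have hmr : m * r = |G 0| := by rw [hr]; field_simp
  have b1 : G r ≤ 0 := by
    have := hl 0 r hr0
    have := le_abs_self (G 0)
    rw [sub_zero, hmr] at *
    linarith
  have b2 : 0 ≤ G (-r) := by
    have := hl (-r) 0 (by linarith)
    have := neg_abs_le (G 0)
    rw [zero_sub, neg_neg, hmr] at *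
    linarith
  obtain ⟨t, -, ht⟩ := intermediate_value_Icc' (by linarith : -r ≤ r) hc.continuousOn ⟨b1, b2⟩
  refine ⟨t, ht, fun s hs => ?_⟩
  simp only at hs
  rcases le_total s t with h | h
  · have := hl s t h
    nlinarith
  · have := hl t s h
    nlinarith

theorem existsUnique_empExpectile {n : ℕ} (hn : n ≠ 0) (x : Fin n → ℝ) {α : ℝ} (h0 : 0 < α)
    (h1 : α < 1) : ∃! t : ℝ, 1 / (n : ℝ) * ∑ i, ident α t (x i) = 0 := by
  have hn' : (0 : ℝ) < n := by positivity
  refine existsUnique_root (m := α * (1 - α)) (mul_pos h0 (by linarith)) ?_ ?_ <;> intro s t h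
  · rw [← mul_sub, ← Finset.sum_sub_distrib]
    have := Finset.sum_le_sum fun i (_ : i ∈ Finset.univ) => ident_sub_le h0 h1 h (x i)
    rw [Finset.sum_const, Finset.card_univ, Fintype.card_fin, nsmul_eq_mul] at this
    rw [one_div, inv_mul_le_iff₀ hn']
    exact this
  · rw [← mul_sub, ← Finset.sum_sub_distrib]
    have := Finset.sum_le_sum fun i (_ : i ∈ Finset.univ) => le_ident_sub h0 h1 h (x i)
    rw [Finset.sum_const, Finset.card_univ, Fintype.card_fin, nsmul_eq_mul] at this
    rw [one_div, le_inv_mul_iff₀ hn']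
    exact this

theorem loss_sub_le {α : ℝ} (h0 : 0 < α) (h1 : α < 1) (s t y : ℝ) :
    loss α (y - s) - loss α (y - t) ≤ -2 * (s - t) * ident α t y + (s - t) ^ 2 := by
  have e0 := mul_nonneg h0.le (sq_nonneg (s - t))
  have e1 := mul_nonneg (sub_pos.2 h1).le (sq_nonneg (s - t))
  rcases le_or_gt s y with a | a <;> rcases le_or_gt t y with b | b
  · rw [loss, loss, ident, if_pos (sub_nonneg.2 a), if_pos (sub_nonneg.2 b), if_pos b]
    nlinarith
  · rw [loss, loss, ident, if_pos (sub_nonneg.2 a),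
      if_neg (show ¬0 ≤ y - t by linarith), if_neg (show ¬t ≤ y by linarith)]
    have f := mul_nonneg (sub_nonneg.2 a) (sub_nonneg.2 b.le)
    nlinarith [mul_nonneg h0.le f, mul_nonneg (sub_pos.2 h1).le f,
      mul_nonneg h0.le (sq_nonneg (y - s)), mul_nonneg h0.le (sq_nonneg (y - t)),
      mul_nonneg (sub_pos.2 h1).le (sq_nonneg (y - s)),
      mul_nonneg (sub_pos.2 h1).le (sq_nonneg (y - t))]
  · rw [loss, loss, ident, if_neg (show ¬0 ≤ y - s by linarith), if_pos (sub_nonneg.2 b), if_pos b]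
    have f := mul_nonneg (sub_nonneg.2 a.le) (sub_nonneg.2 b)
    nlinarith [mul_nonneg h0.le f, mul_nonneg (sub_pos.2 h1).le f,
      mul_nonneg h0.le (sq_nonneg (y - s)), mul_nonneg h0.le (sq_nonneg (y - t)),
      mul_nonneg (sub_pos.2 h1).le (sq_nonneg (y - s)),
      mul_nonneg (sub_pos.2 h1).le (sq_nonneg (y - t))]
  · rw [loss, loss, ident, if_neg (show ¬0 ≤ y - s by linarith),
      if_neg (show ¬0 ≤ y - t by linarith), if_neg (show ¬t ≤ y by linarith)]
    nlinarith

theorem le_loss_sub {α : ℝ} (h0 : 0 < α) (h1 : α < 1) (s t y : ℝ) :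
    -2 * (s - t) * ident α t y + α * (1 - α) * (s - t) ^ 2 ≤ loss α (y - s) - loss α (y - t) := by
  have k := mul_pos h0 (sub_pos.2 h1)
  have hα : 0 ≤ α - α * (1 - α) := by nlinarith
  have hα' : 0 ≤ (1 - α) - α * (1 - α) := by nlinarith
  have e0 := mul_nonneg hα (sq_nonneg (s - t))
  have e1 := mul_nonneg hα' (sq_nonneg (s - t))
  rcases le_or_gt s y with a | a <;> rcases le_or_gt t y with b | b
  · rw [loss, loss, ident, if_pos (sub_nonneg.2 a), if_pos (sub_nonneg.2 b), if_pos b]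
    nlinarith
  · rw [loss, loss, ident, if_pos (sub_nonneg.2 a),
      if_neg (show ¬0 ≤ y - t by linarith), if_neg (show ¬t ≤ y by linarith)]
    have f := mul_nonneg (sub_nonneg.2 a) (sub_nonneg.2 b.le)
    nlinarith [mul_nonneg k.le f, sq_nonneg (α * (y - s) - (1 - α) * (t - y)), mul_nonneg h0.le f, mul_nonneg (sub_pos.2 h1).le f,
      sq_nonneg (α * (t - y)), sq_nonneg (α * (y - s)),
      sq_nonneg ((1 - α) * (t - y)), sq_nonneg ((1 - α) * (y - s)),
      sq_nonneg (α * (y - s) + (1 - α) * (y - t)), mul_nonneg (sq_nonneg (1 - α)) f,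
      mul_nonneg (sq_nonneg α) f]
  · rw [loss, loss, ident, if_neg (show ¬0 ≤ y - s by linarith), if_pos (sub_nonneg.2 b), if_pos b]
    have f := mul_nonneg (sub_nonneg.2 a.le) (sub_nonneg.2 b)
    nlinarith [mul_nonneg k.le f, sq_nonneg (α * (y - s) - (1 - α) * (t - y)), mul_nonneg h0.le f, mul_nonneg (sub_pos.2 h1).le f,
      sq_nonneg (α * (t - y)), sq_nonneg (α * (y - s)),
      sq_nonneg ((1 - α) * (t - y)), sq_nonneg ((1 - α) * (y - s)),
      sq_nonneg (α * (y - s) + (1 - α) * (y - t)), mul_nonneg (sq_nonneg (1 - α)) f,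
      mul_nonneg (sq_nonneg α) f]
  · rw [loss, loss, ident, if_neg (show ¬0 ≤ y - s by linarith),
      if_neg (show ¬0 ≤ y - t by linarith), if_neg (show ¬t ≤ y by linarith)]
    nlinarith

theorem measurable_ident (α t : ℝ) : Measurable (ident α t) :=
  Measurable.ite measurableSet_Ici (by fun_prop) (by fun_prop)

theorem measurable_loss (α : ℝ) : Measurable (loss α) :=
  Measurable.ite measurableSet_Ici (by fun_prop) (by fun_prop)

section WellDefined

variable {Ω : Type*} [MeasurableSpace Ω] {P : Measure Ω} [IsProbabilityMeasure P] {X : Ω → ℝ}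

theorem integrable_ident (hX : Integrable X P) (α t : ℝ) :
    Integrable (fun ω => ident α t (X ω)) P := by
  refine Integrable.mono' (g := fun ω => (|α| + |1 - α|) * |X ω - t|)
    ((hX.sub (integrable_const t)).abs.const_mul _)
    ((measurable_ident α t).comp_aemeasurable hX.aemeasurable).aestronglyMeasurable
    (ae_of_all _ fun ω => ?_)
  have a1 := mul_nonneg (abs_nonneg α) (abs_nonneg (X ω - t))
  have a2 := mul_nonneg (abs_nonneg (1 - α)) (abs_nonneg (X ω - t))
  unfold ident
  split_ifs
  · rw [Real.norm_eq_abs, abs_mul]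
    linarith
  · rw [Real.norm_eq_abs, abs_neg, abs_mul, abs_sub_comm t]
    linarith

theorem integrable_loss (hX : Integrable X P) {α : ℝ} (h0 : 0 < α) (h1 : α < 1) (s : ℝ) :
    Integrable (fun ω => loss α (X ω - s) - loss α (X ω)) P := by
  refine Integrable.mono' (g := fun ω => |(-2 * s) * ident α 0 (X ω)| + s ^ 2)
    (((integrable_ident hX α 0).const_mul _).abs.add (integrable_const _)) ?_
    (ae_of_all _ fun ω => ?_)
  · exact (((measurable_loss α).comp_aemeasurable (hX.aemeasurable.sub_const s)).sub
      ((measurable_loss α).comp_aemeasurable hX.aemeasurable)).aestronglyMeasurable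
  · have a1 := loss_sub_le h0 h1 s 0 (X ω)
    have a2 := le_loss_sub h0 h1 s 0 (X ω)
    rw [sub_zero, sub_zero] at a1 a2
    have a3 : 0 ≤ α * (1 - α) * s ^ 2 := mul_nonneg (mul_nonneg h0.le (by linarith)) (sq_nonneg s)
    rw [Real.norm_eq_abs, abs_le]
    constructor
    · have := neg_abs_le ((-2 * s) * ident α 0 (X ω))
      nlinarith [sq_nonneg s]
    · have := le_abs_self ((-2 * s) * ident α 0 (X ω))
      linarith

/-- First order condition: `t` minimizes the expected loss iff `E I_α(t, X) = 0`. -/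
theorem isExpectile_iff (hX : Integrable X P) {α : ℝ} (h0 : 0 < α) (h1 : α < 1) (t : ℝ) :
    IsExpectile P X α t ↔ ∫ ω, ident α t (X ω) ∂P = 0 := by
  have hI := integrable_ident hX α t
  have hd : ∀ s, ∫ ω, (loss α (X ω - s) - loss α (X ω)) ∂P
      - ∫ ω, (loss α (X ω - t) - loss α (X ω)) ∂P
      = ∫ ω, (loss α (X ω - s) - loss α (X ω - t)) ∂P := fun s => by
    rw [← integral_sub (integrable_loss hX h0 h1 s) (integrable_loss hX h0 h1 t)]
    congr 1 with ω
    ring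
  have hi : ∀ s, Integrable (fun ω => loss α (X ω - s) - loss α (X ω - t)) P := fun s => by
    refine ((integrable_loss hX h0 h1 s).sub (integrable_loss hX h0 h1 t)).congr
      (ae_of_all _ fun ω => ?_)
    simp
  have hg : ∀ s c : ℝ, Integrable (fun ω => -2 * (s - t) * ident α t (X ω) + c) P := fun s c =>
    (hI.const_mul _).add (integrable_const c)
  have hv : ∀ s c : ℝ, ∫ ω, (-2 * (s - t) * ident α t (X ω) + c) ∂P
      = -2 * (s - t) * ∫ ω, ident α t (X ω) ∂P + c := fun s c => by
    rw [integral_add (hI.const_mul _) (integrable_const c), integral_const_mul]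
    simp
  constructor
  · intro h
    have h' := h (t + ∫ ω, ident α t (X ω) ∂P)
    have u := integral_mono (hi (t + ∫ ω, ident α t (X ω) ∂P)) (hg _ _)
      fun ω => loss_sub_le h0 h1 (t + ∫ ω, ident α t (X ω) ∂P) t (X ω)
    rw [← hd, hv] at u
    have : (∫ ω, ident α t (X ω) ∂P) ^ 2 ≤ 0 := by nlinarith
    exact pow_eq_zero_iff two_ne_zero |>.1 (le_antisymm this (sq_nonneg _))
  · intro h s
    have u := integral_mono (hg _ _) (hi s) fun ω => le_loss_sub h0 h1 s t (X ω)
    rw [← hd, hv, h] at u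
    have := mul_nonneg (mul_pos h0 (sub_pos.2 h1)).le (sq_nonneg (s - t))
    linarith

theorem existsUnique_isExpectile (hX : Integrable X P) {α : ℝ} (h0 : 0 < α) (h1 : α < 1) :
    ∃! t, IsExpectile P X α t := by
  simp only [isExpectile_iff hX h0 h1]
  refine existsUnique_root (m := α * (1 - α)) (mul_pos h0 (by linarith)) ?_ ?_ <;> intro s t h
  · rw [← integral_sub (integrable_ident hX α s) (integrable_ident hX α t)]
    have := integral_mono ((integrable_ident hX α s).sub (integrable_ident hX α t))
      (integrable_const (t - s)) fun ω => ident_sub_le h0 h1 h (X ω)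
    simpa using this
  · rw [← integral_sub (integrable_ident hX α s) (integrable_ident hX α t)]
    have := integral_mono (integrable_const (α * (1 - α) * (t - s)))
      ((integrable_ident hX α s).sub (integrable_ident hX α t))
      fun ω => le_ident_sub h0 h1 h (X ω)
    simpa using this

end WellDefined

end

end ExpectileSkewness

/-!
The empirical expectile is the root of the decreasing function `t ↦ G_n(t)`, the empirical mean of
`I_τ(t, ·)`, whose slopes lie between `-1` and `-τ(1 - τ)`. Hence `|ê_n - e|` is bounded by a
multiple of `|G_n(e)|`, which tends to zero almost surely by the strong law. Expanding `I_τ(·, y)`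
at `e` leaves a remainder supported on `|y - e| ≤ |ê_n - e|`; since the law of `X` has no atom at
`e`, the strong law for indicators of small balls makes its mean negligible. So almost surely
`ê_n - e = G_n(e) / (τ + F(e)(1 - 2τ)) + o(G_n(e))` (`isLittleO_empExpectile`).

The skewness is a quotient of linear functions of `(ê_n(1 - α), ê_n(α), X̄_n)`. Clearing
denominators makes the numerator of its error exactly linear in the three errors, so no delta method
is needed: almost surely `ŝ_{2,n} - s₂` equals the empirical mean of the `influence` function up to
little-o of the three empirical means involved (`ae_isLittleO_empSkew`). These means, multiplied by
`√n`, are bounded in `L²`, so the error is negligible in probability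
(`tendstoInMeasure_zero_of_isLittleO`). The central limit theorem for the influence function together
with Slutsky's theorem gives the limit law, and `asympVar_eq_variance` identifies `σ_α²` as the
variance of the influence function, which is in particular nonnegative. Division by zero plays no
role in the limit: `e_X(α) < e_X(1 - α)` because `X` is not almost surely constant
(`expectile_lt_expectile`).
-/

namespace ExpectileSkewness

/-! ### Empirical means and the empirical expectile -/

/-- The mean `(1/n) ∑_{i < n} f (x i)` of `f` over the first `n` terms of the sequence `x`;
it is `0` for `n = 0`. -/
noncomputable def avg (f : ℝ → ℝ) (x : ℕ → ℝ) (n : ℕ) : ℝ := 1 / (n : ℝ) * ∑ i : Fin n, f (x i)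

theorem avg_add (f g : ℝ → ℝ) (x : ℕ → ℝ) (n : ℕ) :
    avg (fun y => f y + g y) x n = avg f x n + avg g x n := by
  simp only [avg, Finset.sum_add_distrib, mul_add]

theorem avg_sub (f g : ℝ → ℝ) (x : ℕ → ℝ) (n : ℕ) :
    avg (fun y => f y - g y) x n = avg f x n - avg g x n := by
  simp only [avg, Finset.sum_sub_distrib, mul_sub]

theorem avg_const_mul (c : ℝ) (f : ℝ → ℝ) (x : ℕ → ℝ) (n : ℕ) :
    avg (fun y => c * f y) x n = c * avg f x n := by
  simp only [avg, ← Finset.mul_sum]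
  ring

theorem avg_const (c : ℝ) (x : ℕ → ℝ) {n : ℕ} (hn : n ≠ 0) : avg (fun _ => c) x n = c := by
  have : (n : ℝ) ≠ 0 := by exact_mod_cast hn
  simp only [avg, Finset.sum_const, Finset.card_univ, Fintype.card_fin, nsmul_eq_mul]
  field_simp

theorem avg_mono {f g : ℝ → ℝ} (h : ∀ y, f y ≤ g y) (x : ℕ → ℝ) (n : ℕ) :
    avg f x n ≤ avg g x n :=
  mul_le_mul_of_nonneg_left (Finset.sum_le_sum fun i _ => h (x i)) (by positivity)

theorem abs_avg_le (f : ℝ → ℝ) (x : ℕ → ℝ) (n : ℕ) : |avg f x n| ≤ avg (fun y => |f y|) x n := by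
  rw [avg, avg, abs_mul, abs_of_nonneg (by positivity : (0 : ℝ) ≤ 1 / n)]
  exact mul_le_mul_of_nonneg_left (Finset.abs_sum_le_sum_abs _ _) (by positivity)

theorem avg_ident_empExpectile {τ : ℝ} (h0 : 0 < τ) (h1 : τ < 1) (x : ℕ → ℝ) {n : ℕ}
    (hn : n ≠ 0) : avg (ident τ (empExpectile (fun i : Fin n => x i) τ)) x n = 0 :=
  Classical.epsilon_spec (existsUnique_empExpectile hn (fun i : Fin n => x i) h0 h1).exists

theorem le_avg_ident_sub {τ : ℝ} (h0 : 0 < τ) (h1 : τ < 1) {s t : ℝ} (h : s ≤ t) (x : ℕ → ℝ)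
    {n : ℕ} (hn : n ≠ 0) :
    τ * (1 - τ) * (t - s) ≤ avg (ident τ s) x n - avg (ident τ t) x n := by
  rw [← avg_sub, ← avg_const (τ * (1 - τ) * (t - s)) x hn]
  exact avg_mono (fun y => le_ident_sub h0 h1 h y) x n

theorem abs_empExpectile_sub_le {τ : ℝ} (h0 : 0 < τ) (h1 : τ < 1) (e : ℝ) (x : ℕ → ℝ) {n : ℕ}
    (hn : n ≠ 0) :
    τ * (1 - τ) * |empExpectile (fun i : Fin n => x i) τ - e| ≤ |avg (ident τ e) x n| := by
  have hr := avg_ident_empExpectile h0 h1 x hn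
  rcases le_total e (empExpectile (fun i : Fin n => x i) τ) with h | h
  · have := le_avg_ident_sub h0 h1 h x hn
    rw [hr, sub_zero] at this
    rw [abs_of_nonneg (sub_nonneg.2 h)]
    exact this.trans (le_abs_self _)
  · have := le_avg_ident_sub h0 h1 h x hn
    rw [hr, zero_sub] at this
    rw [abs_of_nonpos (sub_nonpos.2 h), neg_sub]
    exact this.trans (neg_le_abs _)

theorem empExpectile_le_iff {τ : ℝ} (h0 : 0 < τ) (h1 : τ < 1) (x : ℕ → ℝ) {n : ℕ}
    (hn : n ≠ 0) (t : ℝ) :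
    empExpectile (fun i : Fin n => x i) τ ≤ t ↔ avg (ident τ t) x n ≤ 0 := by
  have hr := avg_ident_empExpectile h0 h1 x hn
  have hm : 0 < τ * (1 - τ) := mul_pos h0 (sub_pos.2 h1)
  refine ⟨fun h => ?_, fun h => ?_⟩
  · have := le_avg_ident_sub h0 h1 h x hn
    have := mul_nonneg hm.le (sub_nonneg.2 h)
    linarith
  · by_contra! hlt
    have := le_avg_ident_sub h0 h1 hlt.le x hn
    have := mul_pos hm (sub_pos.2 hlt)
    linarith

/-- First order expansion of `I_τ(·, y)` at `e`. The remainder vanishes unless `y` lies within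
`|t - e|` of the kink, which is what makes its empirical mean small when `e` is not an atom. -/
theorem abs_ident_sub_sub_le {τ : ℝ} (h0 : 0 < τ) (h1 : τ < 1) {e t δ : ℝ} (hδ : |t - e| ≤ δ)
    (y : ℝ) :
    |ident τ e y - ident τ t y - (t - e) * (τ + (1 - 2 * τ) * (Set.Iic e).indicator 1 y)| ≤
      |t - e| * (Metric.closedBall e δ).indicator 1 y := by
  have hτ : |1 - 2 * τ| ≤ 1 := abs_le.2 ⟨by linarith, by linarith⟩
  have key : ∀ a b : ℝ, |b| ≤ |t - e| → a = (1 - 2 * τ) * b → |a| ≤ |t - e| * 1 := by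
    rintro a b hb rfl
    rw [abs_mul]
    nlinarith [abs_nonneg b, abs_nonneg (1 - 2 * τ)]
  have hmem : |y - e| ≤ |t - e| → y ∈ Metric.closedBall e δ := fun h => by
    rw [Metric.mem_closedBall, Real.dist_eq]
    exact h.trans hδ
  have hnn : 0 ≤ |t - e| * (Metric.closedBall e δ).indicator 1 y :=
    mul_nonneg (abs_nonneg _) (Set.indicator_nonneg (fun _ _ => zero_le_one) _)
  rcases le_or_gt y e with a | a
  · rw [Set.indicator_of_mem (show y ∈ Set.Iic e from a)]
    rcases le_or_gt t y with b | b
    · have hb : |y - e| ≤ |t - e| := by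
        rw [abs_of_nonpos (by linarith), abs_of_nonpos (by linarith)]; linarith
      rw [Set.indicator_of_mem (hmem hb)]
      refine key _ (y - t) ?_ ?_
      · rw [abs_of_nonneg (by linarith), abs_of_nonpos (by linarith)]; linarith
      · rcases eq_or_lt_of_le a with rfl | c
        · simp only [ident, if_pos b, if_pos le_rfl, Pi.one_apply]; ring
        · simp only [ident, if_pos b, if_neg c.not_ge, Pi.one_apply]; ring
    · refine le_trans (le_of_eq ?_) hnn
      rw [abs_eq_zero]
      rcases eq_or_lt_of_le a with rfl | c
      · simp only [ident, if_neg b.not_ge, if_pos le_rfl, Pi.one_apply]; ring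
      · simp only [ident, if_neg b.not_ge, if_neg c.not_ge, Pi.one_apply]; ring
  · rw [Set.indicator_of_notMem (show y ∉ Set.Iic e from a.not_ge)]
    rcases le_or_gt t y with b | b
    · refine le_trans (le_of_eq ?_) hnn
      rw [abs_eq_zero]
      simp only [ident, if_pos b, if_pos a.le]; ring
    · have hb : |y - e| ≤ |t - e| := by
        rw [abs_of_nonneg (by linarith), abs_of_nonneg (by linarith)]; linarith
      rw [Set.indicator_of_mem (hmem hb)]
      refine key _ (t - y) ?_ ?_
      · rw [abs_of_nonneg (by linarith), abs_of_nonneg (by linarith)]; linarith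
      · simp only [ident, if_neg b.not_ge, if_pos a.le]; ring

/-! ### Linearization along one sequence -/

/-- The empirical expectile is asymptotically linear: `ê_n - e` and `G_n / (τ + F (1 - 2τ))`
differ by `o(G_n)`, where `G_n` is the empirical mean of `I_τ(e, ·)`. The hypothesis `hball`
says that asymptotically the sequence puts little mass near `e`. -/
theorem isLittleO_empExpectile {τ : ℝ} (h0 : 0 < τ) (h1 : τ < 1) {e F : ℝ} {x : ℕ → ℝ}
    (hF0 : 0 ≤ F) (hF1 : F ≤ 1)
    (hG : Tendsto (avg (ident τ e) x) atTop (𝓝 0))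
    (hF : Tendsto (avg ((Set.Iic e).indicator 1) x) atTop (𝓝 F))
    (hball : ∀ ε > 0, ∃ δ > 0, ∀ᶠ n in atTop,
      avg ((Metric.closedBall e δ).indicator 1) x n ≤ ε) :
    (fun n : ℕ => empExpectile (fun i : Fin n => x i) τ - e -
      avg (ident τ e) x n / (τ + F * (1 - 2 * τ))) =o[atTop] avg (ident τ e) x := by
  set E : ℕ → ℝ := fun n => empExpectile (fun i : Fin n => x i) τ - e with hE
  have hm : 0 < τ * (1 - τ) := mul_pos h0 (sub_pos.2 h1)
  have hd : 0 < τ + F * (1 - 2 * τ) := by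
    rcases le_total (1 - 2 * τ) 0 with h | h <;> nlinarith
  set d := τ + F * (1 - 2 * τ)
  have hEO : E =O[atTop] avg (ident τ e) x := by
    refine Asymptotics.IsBigO.of_bound (τ * (1 - τ))⁻¹ ?_
    filter_upwards [eventually_ne_atTop 0] with n hn
    rw [Real.norm_eq_abs, Real.norm_eq_abs, ← div_eq_inv_mul, le_div_iff₀' hm]
    exact abs_empExpectile_sub_le h0 h1 e x hn
  have hE0 : Tendsto E atTop (𝓝 0) := hEO.trans_tendsto hG
  -- since `E = O(G_n)`, an error of order `o(E)` is as good as one of order `o(G_n)`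
  suffices h : (fun n => d * E n - avg (ident τ e) x n) =o[atTop] E by
    refine ((h.const_mul_left d⁻¹).congr_left fun n => ?_).trans_isBigO hEO
    simp only [hE]
    field_simp
  rw [Asymptotics.isLittleO_iff]
  intro c hc
  obtain ⟨δ, hδ, hball⟩ := hball (c / 2) (by positivity)
  have hF' : ∀ᶠ n in atTop, |avg ((Set.Iic e).indicator 1) x n - F| < c / 2 := by
    simpa [Real.dist_eq] using Metric.tendsto_nhds.1 hF (c / 2) (by positivity)
  have hE' : ∀ᶠ n in atTop, |E n| < δ := by
    simpa [Real.dist_eq] using Metric.tendsto_nhds.1 hE0 δ hδ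
  filter_upwards [hball, hF', hE', eventually_ne_atTop 0] with n a1 a2 a3 hn
  have hr := avg_ident_empExpectile h0 h1 x hn
  have key : |avg (ident τ e) x n - 0 -
      E n * (τ + (1 - 2 * τ) * avg ((Set.Iic e).indicator 1) x n)| ≤
      |E n| * avg ((Metric.closedBall e δ).indicator 1) x n := by
    have := (abs_avg_le _ x n).trans (avg_mono (fun y => abs_ident_sub_sub_le h0 h1 a3.le y) x n)
    rwa [avg_sub, avg_sub, avg_const_mul, avg_add, avg_const τ x hn, avg_const_mul, avg_const_mul,
      hr] at this
  rw [Real.norm_eq_abs, Real.norm_eq_abs]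
  set f := avg ((Set.Iic e).indicator 1) x n
  set g := avg (ident τ e) x n
  have e1 : d * E n - g = -(g - 0 - E n * (τ + (1 - 2 * τ) * f)) -
      E n * ((1 - 2 * τ) * (f - F)) := by
    simp only [d]; ring
  have e2 : |(1 - 2 * τ) * (f - F)| ≤ c / 2 := by
    rw [abs_mul]
    have hτ : |1 - 2 * τ| ≤ 1 := abs_le.2 ⟨by linarith, by linarith⟩
    nlinarith [abs_nonneg (f - F), abs_nonneg (1 - 2 * τ)]
  rw [e1]
  refine (abs_sub _ _).trans ?_
  rw [abs_neg, abs_mul]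
  have b1 := mul_le_mul_of_nonneg_left a1 (abs_nonneg (E n))
  have b2 := mul_le_mul_of_nonneg_left e2 (abs_nonneg (E n))
  linarith

/-- Linearization of the quotient `(a + b - 2m) / (a - b)`: after clearing denominators the
numerator of its error is exactly linear in the increments, so only the random denominator has to be
replaced by its limit. -/
theorem isLittleO_skewness_quotient {a b m : ℝ} (hab : b < a) {a' b' m' u v w g : ℕ → ℝ}
    (ha : (fun n => a' n - a - u n) =o[atTop] g) (hb : (fun n => b' n - b - v n) =o[atTop] g)
    (hm : (fun n => m' n - m - w n) =o[atTop] g) (hu : u =O[atTop] g) (hv : v =O[atTop] g)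
    (hw : w =O[atTop] g) (hg : Tendsto g atTop (𝓝 0)) :
    (fun n => (a' n + b' n - 2 * m' n) / (a' n - b' n) - (a + b - 2 * m) / (a - b) -
      2 / (a - b) ^ 2 * ((m - b) * u n + (a - m) * v n - (a - b) * w n)) =o[atTop] g := by
  have hD : a - b ≠ 0 := (sub_pos.2 hab).ne'
  have lim : ∀ {z y : ℕ → ℝ} {c : ℝ}, (fun n => z n - c - y n) =o[atTop] g → y =O[atTop] g →
      Tendsto z atTop (𝓝 c) := fun {z y c} h h' => by
    have : Tendsto (fun n => z n - c) atTop (𝓝 0) := by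
      refine ((h.isBigO.add h').congr_left fun n => ?_).trans_tendsto hg
      ring
    simpa using this.add_const c
  have hDl : Tendsto (fun n => a' n - b' n) atTop (𝓝 (a - b)) :=
    (lim ha hu).sub (lim hb hv)
  have hinv : (fun n => (a' n - b' n)⁻¹ - (a - b)⁻¹) =o[atTop] fun _ => (1 : ℝ) := by
    rw [Asymptotics.isLittleO_one_iff]
    simpa using (hDl.inv₀ hD).sub_const (a - b)⁻¹
  have hbd : (fun n => (a' n - b' n)⁻¹) =O[atTop] fun _ => (1 : ℝ) :=
    (hDl.inv₀ hD).isBigO_one ℝ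
  -- the numerator minus its linearization, and the linearization itself
  have hT := ((ha.const_mul_left (m - b)).add (hb.const_mul_left (a - m))).sub
    (hm.const_mul_left (a - b))
  have hL := ((hu.const_mul_left (m - b)).add (hv.const_mul_left (a - m))).sub
    (hw.const_mul_left (a - b))
  have h1 := hbd.mul_isLittleO hT
  have h2 := hinv.mul_isBigO hL
  simp only [one_mul] at h1 h2
  refine ((h1.add h2).const_mul_left (2 / (a - b))).congr' ?_ EventuallyEq.rfl
  filter_upwards [hDl.eventually_ne hD] with n hn
  field_simp
  ring

/-! ### Empirical means of an i.i.d. sequence -/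

section Sequence

variable {Ω : Type*} [MeasurableSpace Ω] {P : Measure Ω} [IsProbabilityMeasure P]
  {X : Ω → ℝ} {Xs : ℕ → Ω → ℝ}

theorem avg_eq_range (f : ℝ → ℝ) (x : ℕ → ℝ) (n : ℕ) :
    avg f x n = (n : ℝ)⁻¹ * ∑ i ∈ Finset.range n, f (x i) := by
  rw [avg, one_div, Fin.sum_univ_eq_sum_range fun i => f (x i)]

theorem measurable_avg {f : ℝ → ℝ} (hf : Measurable f) (n : ℕ) :
    Measurable fun x : ℕ → ℝ => avg f x n :=
  Measurable.const_mul (Finset.measurable_fun_sum _ fun _ _ =>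
    hf.comp (measurable_pi_apply _)) _

omit [IsProbabilityMeasure P] in
theorem aemeasurable_avg (hident : ∀ i, IdentDistrib (Xs i) X P P) {f : ℝ → ℝ}
    (hf : Measurable f) (n : ℕ) : AEMeasurable (fun ω => avg f (fun i => Xs i ω) n) P :=
  (measurable_avg hf n).comp_aemeasurable
    (aemeasurable_pi_lambda _ fun i => (hident i).aemeasurable_fst)

/-- Measurability follows from `empExpectile_le_iff`; for `n = 0` the function is constant. -/
theorem measurable_empExpectile {τ : ℝ} (h0 : 0 < τ) (h1 : τ < 1) (n : ℕ) :
    Measurable fun x : ℕ → ℝ => empExpectile (fun i : Fin n => x i) τ := by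
  rcases eq_or_ne n 0 with rfl | hn
  · have : (fun x : ℕ → ℝ => empExpectile (fun i : Fin 0 => x i) τ) =
        fun _ => empExpectile (fun _ : Fin 0 => 0) τ := by
      ext x
      exact congrArg (empExpectile · τ) (Subsingleton.elim _ _)
    rw [this]
    exact measurable_const
  · refine measurable_of_Iic fun t => ?_
    have : (fun x : ℕ → ℝ => empExpectile (fun i : Fin n => x i) τ) ⁻¹' Set.Iic t =
        {x | avg (ident τ t) x n ≤ 0} := by
      ext x
      exact empExpectile_le_iff h0 h1 x hn t
    rw [this]
    exact measurableSet_le (measurable_avg (measurable_ident τ t) n) measurable_const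

omit [IsProbabilityMeasure P] in
theorem ae_tendsto_avg (hindep : iIndepFun Xs P) (hident : ∀ i, IdentDistrib (Xs i) X P P)
    {f : ℝ → ℝ} (hf : Measurable f) (hint : Integrable (fun ω => f (X ω)) P) :
    ∀ᵐ ω ∂P, Tendsto (avg f fun i => Xs i ω) atTop (𝓝 (∫ ω, f (X ω) ∂P)) := by
  have hid : ∀ i, IdentDistrib (fun ω => f (Xs i ω)) (fun ω => f (X ω)) P P :=
    fun i => (hident i).comp hf
  have h := strong_law_ae (μ := P) (fun i ω => f (Xs i ω)) ((hid 0).integrable_iff.2 hint)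
    (fun i j hij => (hindep.indepFun hij).comp hf hf) fun i => (hid i).trans (hid 0).symm
  filter_upwards [h] with ω hω
  rw [(hid 0).integral_eq] at hω
  refine hω.congr fun n => ?_
  rw [avg_eq_range, smul_eq_mul]

theorem ae_tendsto_avg_indicator (hindep : iIndepFun Xs P)
    (hident : ∀ i, IdentDistrib (Xs i) X P P) {s : Set ℝ} (hs : MeasurableSet s) :
    ∀ᵐ ω ∂P, Tendsto (avg (s.indicator 1) fun i => Xs i ω) atTop (𝓝 ((P.map X).real s)) := by
  have hX := (hident 0).aemeasurable_snd
  have := Measure.isProbabilityMeasure_map (μ := P) hX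
  have hm : Measurable (s.indicator (1 : ℝ → ℝ)) := measurable_one.indicator hs
  have hi : Integrable (s.indicator (1 : ℝ → ℝ)) (P.map X) :=
    (integrable_const (1 : ℝ)).indicator hs
  have h := ae_tendsto_avg hindep hident hm (hi.comp_aemeasurable hX)
  rwa [← integral_map hX hm.aestronglyMeasurable, integral_indicator_one hs] at h

/-- If the law of `X` has no atom at `e`, then almost surely the proportion of observations near
`e` is eventually arbitrarily small. -/
theorem ae_eventually_avg_closedBall_le (hindep : iIndepFun Xs P)
    (hident : ∀ i, IdentDistrib (Xs i) X P P) {e : ℝ} (he : (P.map X) {e} = 0) :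
    ∀ᵐ ω ∂P, ∀ ε > 0, ∃ δ > 0, ∀ᶠ n in atTop,
      avg ((Metric.closedBall e δ).indicator 1) (fun i => Xs i ω) n ≤ ε := by
  have hX := (hident 0).aemeasurable_snd
  have := Measure.isProbabilityMeasure_map (μ := P) hX
  have hlim : Tendsto (fun k : ℕ => (P.map X).real (Metric.closedBall e (1 / ((k : ℝ) + 1))))
      atTop (𝓝 0) := by
    have h := tendsto_measure_cthickening_of_isClosed (μ := P.map X) (s := {e})
      ⟨1, one_pos, measure_ne_top _ _⟩ isClosed_singleton
    have h' := (ENNReal.tendsto_toReal (measure_ne_top _ _)).comp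
      (h.comp (tendsto_one_div_add_atTop_nhds_zero_nat (𝕜 := ℝ)))
    rw [he, ENNReal.toReal_zero] at h'
    refine h'.congr fun k => ?_
    simp only [Function.comp_apply, Measure.real]
    rw [Metric.cthickening_singleton _ (by positivity)]
  have hall : ∀ᵐ ω ∂P, ∀ k : ℕ, Tendsto
      (avg ((Metric.closedBall e (1 / ((k : ℝ) + 1))).indicator 1) fun i => Xs i ω) atTop
      (𝓝 ((P.map X).real (Metric.closedBall e (1 / ((k : ℝ) + 1))))) :=
    ae_all_iff.2 fun k => ae_tendsto_avg_indicator hindep hident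
      Metric.isClosed_closedBall.measurableSet
  filter_upwards [hall] with ω hω ε hε
  obtain ⟨k, hk⟩ := (hlim.eventually_lt_const hε).exists
  exact ⟨1 / ((k : ℝ) + 1), by positivity, ((hω k).eventually_lt_const hk).mono fun n => le_of_lt⟩

/-- The central limit theorem for `√n` times the empirical mean of `f`, for centred `f(X)`. -/
theorem tendstoInDistribution_sqrt_mul_avg (hindep : iIndepFun Xs P)
    (hident : ∀ i, IdentDistrib (Xs i) X P P) {f : ℝ → ℝ} (hf : Measurable f)
    (hL2 : MemLp (fun ω => f (X ω)) 2 P) (h0 : ∫ ω, f (X ω) ∂P = 0) :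
    TendstoInDistribution (fun (n : ℕ) ω => √n * avg f (fun i => Xs i ω) n) atTop id (fun _ => P)
      (gaussianReal 0 Var[fun ω => f (X ω); P].toNNReal) := by
  have hid : ∀ i, IdentDistrib (fun ω => f (Xs i ω)) (fun ω => f (X ω)) P P :=
    fun i => (hident i).comp hf
  have h := tendstoInDistribution_inv_sqrt_mul_sum_sub (P := P) (X := fun i ω => f (Xs i ω))
    (Y := id) (P' := gaussianReal 0 Var[fun ω => f (X ω); P].toNNReal)
    (by rw [(hid 0).variance_eq]; exact HasLaw.id) ((hid 0).memLp_iff.2 hL2)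
    (hindep.comp (fun _ => f) fun _ => hf) fun i => (hid i).trans (hid 0).symm
  rw [(hid 0).integral_eq, h0] at h
  convert h using 3 with n ω
  rw [avg_eq_range, mul_zero, sub_zero, ← mul_assoc]
  congr 1
  rw [← div_eq_mul_inv, Real.sqrt_div_self', one_div]

/-- The second moment of `√n` times the empirical mean of a centred `f(X)` is bounded in `n`. -/
theorem integral_sq_sqrt_mul_avg_le (hindep : iIndepFun Xs P)
    (hident : ∀ i, IdentDistrib (Xs i) X P P) {f : ℝ → ℝ} (hf : Measurable f)
    (hL2 : MemLp (fun ω => f (X ω)) 2 P) (h0 : ∫ ω, f (X ω) ∂P = 0) (n : ℕ) :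
    Integrable (fun ω => (√n * avg f (fun i => Xs i ω) n) ^ 2) P ∧
      ∫ ω, (√n * avg f (fun i => Xs i ω) n) ^ 2 ∂P ≤ Var[fun ω => f (X ω); P] := by
  have hid : ∀ i, IdentDistrib (fun ω => f (Xs i ω)) (fun ω => f (X ω)) P P :=
    fun i => (hident i).comp hf
  have hLi : ∀ i, MemLp (fun ω => f (Xs i ω)) 2 P := fun i => (hid i).memLp_iff.2 hL2
  have hsum : MemLp (fun ω => ∑ i ∈ Finset.range n, f (Xs i ω)) 2 P :=
    memLp_finsetSum _ fun i _ => hLi i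
  have he : (fun ω => (√n * avg f (fun i => Xs i ω) n) ^ 2) =
      fun ω => (n : ℝ)⁻¹ * (∑ i ∈ Finset.range n, f (Xs i ω)) ^ 2 := by
    ext ω
    rw [avg_eq_range, mul_pow, mul_pow, Real.sq_sqrt n.cast_nonneg]
    rcases eq_or_ne n 0 with rfl | hn
    · simp
    · field_simp
  rw [he]
  refine ⟨hsum.integrable_sq.const_mul _, ?_⟩
  have hmean : ∫ ω, ∑ i ∈ Finset.range n, f (Xs i ω) ∂P = 0 := by
    rw [integral_finsetSum _ fun i _ => (hLi i).integrable one_le_two]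
    exact Finset.sum_eq_zero fun i _ => (hid i).integral_eq.trans h0
  have hv := IndepFun.variance_sum (μ := P) (s := Finset.range n) (X := fun i ω => f (Xs i ω))
    (fun i _ => hLi i) fun i _ j _ hij => (hindep.indepFun hij).comp hf hf
  rw [Finset.sum_congr rfl fun i _ => (hid i).variance_eq, Finset.sum_const, Finset.card_range,
    nsmul_eq_mul] at hv
  have hv' : ∫ ω, (∑ i ∈ Finset.range n, f (Xs i ω)) ^ 2 ∂P = n * Var[fun ω => f (X ω); P] := by
    rw [← hv, show (∑ i ∈ Finset.range n, fun ω => f (Xs i ω)) =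
      fun ω => ∑ i ∈ Finset.range n, f (Xs i ω) by ext; simp,
      variance_of_integral_eq_zero hsum.aemeasurable hmean]
  rw [integral_const_mul, hv']
  rcases eq_or_ne n 0 with rfl | hn
  · simp [variance_nonneg]
  · have : (n : ℝ) ≠ 0 := by exact_mod_cast hn
    rw [inv_mul_cancel_left₀ this]

/-- A sequence that is almost surely `o(V_n)` tends to zero in probability when `V_n` is bounded in
`L²`. -/
theorem tendstoInMeasure_zero_of_isLittleO {R V : ℕ → Ω → ℝ} {C : ℝ}
    (hR : ∀ n, AEMeasurable (R n) P) (hVm : ∀ n, AEMeasurable (V n) P)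
    (hVi : ∀ n, Integrable (fun ω => V n ω ^ 2) P) (hV : ∀ n, ∫ ω, V n ω ^ 2 ∂P ≤ C)
    (hRV : ∀ᵐ ω ∂P, (fun n => R n ω) =o[atTop] fun n => V n ω) :
    TendstoInMeasure P R atTop 0 := by
  have hC : 0 ≤ C := (integral_nonneg fun ω => sq_nonneg (V 0 ω)).trans (hV 0)
  -- `1 + V²` in place of `V²` keeps the ratio `Q` meaningful where `V` vanishes
  set Q : ℕ → Ω → ℝ := fun n ω => R n ω ^ 2 / (1 + V n ω ^ 2) with hQ
  have hQ0 : TendstoInMeasure P Q atTop fun _ => 0 := by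
    refine tendstoInMeasure_of_tendsto_ae (fun n => AEMeasurable.aestronglyMeasurable ?_) ?_
    · exact ((hR n).pow_const 2).div (((hVm n).pow_const 2).const_add 1)
    · filter_upwards [hRV] with ω hω
      have h := hω.pow two_pos
      have hO : (fun n => V n ω ^ 2) =O[atTop] fun n => 1 + V n ω ^ 2 := by
        refine Asymptotics.IsBigO.of_bound 1 (Eventually.of_forall fun n => ?_)
        rw [Real.norm_eq_abs, Real.norm_eq_abs, abs_of_nonneg (sq_nonneg _), abs_of_nonneg
          (by positivity)]
        linarith
      exact (h.trans_isBigO hO).tendsto_div_nhds_zero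
  rw [tendstoInMeasure_iff_measureReal_norm] at hQ0 ⊢
  intro ε hε
  simp only [Pi.zero_apply, sub_zero] at hQ0 ⊢
  rw [Metric.tendsto_nhds]
  intro r hr
  -- chosen so that `(1 + C) * δ / ε ^ 2 < r / 2`
  set δ : ℝ := ε ^ 2 * r / (4 * (1 + C)) with hδ
  have hδ0 : 0 < δ := by positivity
  filter_upwards [(hQ0 δ hδ0).eventually_lt_const (half_pos hr)] with n hn
  rw [Real.dist_0_eq_abs, abs_of_nonneg measureReal_nonneg]
  have hsub : {ω | ε ≤ ‖R n ω‖} ⊆ {ω | δ ≤ ‖Q n ω‖} ∪ {ω | ε ^ 2 / δ ≤ 1 + V n ω ^ 2} := by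
    intro ω hω
    by_contra hcon
    simp only [Set.mem_union, Set.mem_ofPred_eq, not_or, not_le] at hcon
    obtain ⟨c1, c2⟩ := hcon
    have hW : 0 < 1 + V n ω ^ 2 := by positivity
    rw [lt_div_iff₀ hδ0] at c2
    have c3 : R n ω ^ 2 < δ * (1 + V n ω ^ 2) := by
      have := (le_abs_self _).trans_lt c1
      rwa [hQ, div_lt_iff₀ hW] at this
    have c4 : ε ^ 2 ≤ R n ω ^ 2 := by
      rw [← sq_abs (R n ω)]
      exact pow_le_pow_left₀ hε.le hω 2
    linarith
  have hmk := mul_meas_ge_le_integral_of_nonneg (μ := P) (f := fun ω => 1 + V n ω ^ 2)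
    (ae_of_all _ fun ω => by positivity) ((integrable_const 1).add (hVi n)) (ε ^ 2 / δ)
  rw [integral_add (integrable_const 1) (hVi n)] at hmk
  simp only [integral_const, probReal_univ, smul_eq_mul, mul_one] at hmk
  have h2 : P.real {ω | ε ^ 2 / δ ≤ 1 + V n ω ^ 2} ≤ r / 4 := by
    have e : ε ^ 2 / δ = 4 * (1 + C) / r := by rw [hδ]; field_simp
    rw [e] at hmk ⊢
    have : 4 * (1 + C) / r * P.real {ω | 4 * (1 + C) / r ≤ 1 + V n ω ^ 2} ≤ 1 + C :=
      hmk.trans (by linarith [hV n])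
    have hc : 0 < 1 + C := by linarith
    rw [div_mul_eq_mul_div, div_le_iff₀ hr] at this
    nlinarith
  have := (measureReal_mono (μ := P) hsub).trans (measureReal_union_le _ _)
  linarith

end Sequence

/-! ### Population expectiles and the asymptotic variance -/

section Population

variable {Ω : Type*} [MeasurableSpace Ω] {P : Measure Ω} [IsProbabilityMeasure P] {X : Ω → ℝ}

theorem memLp_ident (hX : MemLp X 2 P) {τ : ℝ} (h0 : 0 < τ) (h1 : τ < 1) (t : ℝ) :
    MemLp (fun ω => ident τ t (X ω)) 2 P := by
  refine (hX.sub (memLp_const t)).mono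
    ((measurable_ident τ t).comp_aemeasurable hX.aemeasurable).aestronglyMeasurable
    (ae_of_all _ fun ω => ?_)
  rw [Pi.sub_apply, Real.norm_eq_abs, Real.norm_eq_abs]
  unfold ident
  split_ifs with h
  · rw [abs_mul, abs_of_pos h0]
    exact mul_le_of_le_one_left (abs_nonneg _) h1.le
  · rw [abs_neg, abs_mul, abs_of_pos (sub_pos.2 h1), abs_sub_comm t]
    exact mul_le_of_le_one_left (abs_nonneg _) (by linarith)

theorem integral_ident_expectile (hX : Integrable X P) {τ : ℝ} (h0 : 0 < τ) (h1 : τ < 1) :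
    ∫ ω, ident τ (expectile P X τ) (X ω) ∂P = 0 :=
  (isExpectile_iff hX h0 h1 _).1
    (Classical.epsilon_spec (existsUnique_isExpectile hX h0 h1).exists)

theorem ident_one_half (t y : ℝ) : ident (1 / 2) t y = (y - t) / 2 := by
  unfold ident
  split_ifs <;> ring

theorem expectile_one_half (hX : Integrable X P) : expectile P X (1 / 2) = ∫ ω, X ω ∂P := by
  have h := integral_ident_expectile hX (τ := 1 / 2) (by norm_num) (by norm_num)
  simp only [ident_one_half] at h
  rw [integral_div, integral_sub hX (integrable_const _)] at h
  simp only [integral_const, probReal_univ, smul_eq_mul, one_mul] at h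
  linarith

/-- The expectiles at `α` and `1 - α` are distinct unless `X` is almost surely constant. -/
theorem expectile_lt_expectile (hX : Integrable X P) {α : ℝ} (h0 : 0 < α) (h1 : α < 1 / 2)
    (hatom : (P.map X) {expectile P X α} = 0) :
    expectile P X α < expectile P X (1 - α) := by
  set b := expectile P X α with hb
  set a := expectile P X (1 - α) with ha
  have hIb : ∫ ω, ident α b (X ω) ∂P = 0 := integral_ident_expectile hX h0 (by linarith)
  have hIa : ∫ ω, ident (1 - α) a (X ω) ∂P = 0 :=
    integral_ident_expectile hX (by linarith) (by linarith)
  by_contra! hle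
  have hmono : ∫ ω, ident (1 - α) b (X ω) ∂P ≤ ∫ ω, ident (1 - α) a (X ω) ∂P := by
    refine integral_mono (integrable_ident hX _ _) (integrable_ident hX _ _) fun ω => ?_
    have := le_ident_sub (α := 1 - α) (by linarith) (by linarith) hle (X ω)
    have h' : 0 ≤ (1 - α) * (1 - (1 - α)) * (b - a) :=
      mul_nonneg (mul_nonneg (by linarith) (by linarith)) (sub_nonneg.2 hle)
    show ident (1 - α) b (X ω) ≤ ident (1 - α) a (X ω)
    linarith
  -- `I_{1-α}(b, y) - I_α(b, y) = (1 - 2α) |y - b|`, so `a ≤ b` would force `E|X - b| = 0`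
  have habs : Integrable (fun ω => |X ω - b|) P := (hX.sub (integrable_const b)).abs
  have hdiff : ∫ ω, ident (1 - α) b (X ω) ∂P = (1 - 2 * α) * ∫ ω, |X ω - b| ∂P := by
    rw [← sub_zero (∫ ω, ident (1 - α) b (X ω) ∂P), ← hIb,
      ← integral_sub (integrable_ident hX _ _) (integrable_ident hX _ _), ← integral_const_mul]
    congr 1 with ω
    unfold ident
    split_ifs with h
    · rw [abs_of_nonneg (by linarith)]; ring
    · rw [abs_of_neg (by linarith)]; ring
  have hz : ∫ ω, |X ω - b| ∂P = 0 := by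
    have h2 : 0 < 1 - 2 * α := by linarith
    refine le_antisymm ?_ (integral_nonneg fun ω => abs_nonneg _)
    by_contra! hpos
    have := mul_pos h2 hpos
    linarith
  rw [integral_eq_zero_iff_of_nonneg (fun ω => abs_nonneg _) habs] at hz
  have h1' : ∀ᵐ ω ∂P, X ω ∈ ({b} : Set ℝ)ᶜ := by
    rw [Measure.map_apply_of_aemeasurable hX.aemeasurable (measurableSet_singleton b)] at hatom
    exact measure_eq_zero_iff_ae_notMem.1 hatom
  obtain ⟨ω, c1, c2⟩ := (hz.and h1').exists
  exact c2 (sub_eq_zero.1 (abs_eq_zero.1 c1))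

/-- The influence function of the expectile skewness:
`√n (ŝ_{2,n}(α) - s₂(α))` is asymptotically `√n` times its empirical mean. -/
noncomputable def influence (P : Measure Ω) (X : Ω → ℝ) (α y : ℝ) : ℝ :=
  2 / ((1 - 2 * α) * (expectile P X (1 - α) - expectile P X α) ^ 2) *
    (coefA P X α * ident α (expectile P X α) y +
      coefA P X (1 - α) * ident (1 - α) (expectile P X (1 - α)) y -
      2 * (expectile P X (1 - α) - expectile P X α) *
        ident (1 / 2) (expectile P X (1 / 2)) y)

theorem measurable_influence (P : Measure Ω) (X : Ω → ℝ) (α : ℝ) :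
    Measurable (influence P X α) :=
  ((((measurable_ident _ _).const_mul _).add ((measurable_ident _ _).const_mul _)).sub
    ((measurable_ident _ _).const_mul _)).const_mul _

theorem memLp_influence (hX : MemLp X 2 P) {α : ℝ} (h0 : 0 < α) (h1 : α < 1 / 2) :
    MemLp (fun ω => influence P X α (X ω)) 2 P :=
  ((((memLp_ident hX h0 (by linarith) _).const_mul _).add
    ((memLp_ident hX (τ := 1 - α) (by linarith) (by linarith) _).const_mul _)).sub
    ((memLp_ident hX (τ := 1 / 2) (by norm_num) (by norm_num) _).const_mul _)).const_mul _

theorem integral_influence (hX : MemLp X 2 P) {α : ℝ} (h0 : 0 < α) (h1 : α < 1 / 2) :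
    ∫ ω, influence P X α (X ω) ∂P = 0 := by
  have hX' := hX.integrable one_le_two
  have i1 := integrable_ident hX' α (expectile P X α)
  have i2 := integrable_ident hX' (1 - α) (expectile P X (1 - α))
  have i3 := integrable_ident hX' (1 / 2) (expectile P X (1 / 2))
  unfold influence
  rw [integral_const_mul, integral_sub ((i1.const_mul _).fun_add (i2.const_mul _)) (i3.const_mul _),
    integral_add (i1.const_mul _) (i2.const_mul _), integral_const_mul, integral_const_mul,
    integral_const_mul, integral_ident_expectile hX' h0 (by linarith),
    integral_ident_expectile hX' (by linarith) (by linarith),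
    integral_ident_expectile hX' (by norm_num) (by norm_num)]
  ring

/-- The formula for `σ_α²` is the expanded second moment of the centred influence function. -/
theorem asympVar_eq_variance (hX : MemLp X 2 P) {α : ℝ} (h0 : 0 < α) (h1 : α < 1 / 2)
    (hlt : expectile P X α < expectile P X (1 - α)) :
    asympVar P X α = Var[fun ω => influence P X α (X ω); P] := by
  rw [variance_of_integral_eq_zero (memLp_influence hX h0 h1).aemeasurable
    (integral_influence hX h0 h1)]
  have m1 := memLp_ident hX h0 (by linarith) (expectile P X α)
  have m2 := memLp_ident hX (τ := 1 - α) (by linarith) (by linarith) (expectile P X (1 - α))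
  have m3 := memLp_ident hX (τ := 1 / 2) (by norm_num) (by norm_num) (expectile P X (1 / 2))
  have hD : expectile P X (1 - α) - expectile P X α ≠ 0 := (sub_pos.2 hlt).ne'
  have hk : 1 - 2 * α ≠ 0 := by linarith
  have e : ∀ ω, influence P X α (X ω) ^ 2 =
      (2 / ((1 - 2 * α) * (expectile P X (1 - α) - expectile P X α) ^ 2)) ^ 2 *
      (coefA P X α ^ 2 *
          (ident α (expectile P X α) (X ω) * ident α (expectile P X α) (X ω)) +
        2 * coefA P X α * coefA P X (1 - α) * (ident α (expectile P X α) (X ω) *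
          ident (1 - α) (expectile P X (1 - α)) (X ω)) +
        coefA P X (1 - α) ^ 2 * (ident (1 - α) (expectile P X (1 - α)) (X ω) *
          ident (1 - α) (expectile P X (1 - α)) (X ω)) +
        4 * (expectile P X (1 - α) - expectile P X α) ^ 2 *
          (ident (1 / 2) (expectile P X (1 / 2)) (X ω) *
            ident (1 / 2) (expectile P X (1 / 2)) (X ω)) +
        (-4 * (expectile P X (1 - α) - expectile P X α) * coefA P X α) *
          (ident α (expectile P X α) (X ω) * ident (1 / 2) (expectile P X (1 / 2)) (X ω)) +
        (-4 * (expectile P X (1 - α) - expectile P X α) * coefA P X (1 - α)) *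
          (ident (1 / 2) (expectile P X (1 / 2)) (X ω) *
            ident (1 - α) (expectile P X (1 - α)) (X ω))) := fun ω => by
    unfold influence
    ring
  have p11 := m1.integrable_mul m1
  have p12 := m1.integrable_mul m2
  have p22 := m2.integrable_mul m2
  have p33 := m3.integrable_mul m3
  have p13 := m1.integrable_mul m3
  have p32 := m3.integrable_mul m2
  simp only [Pi.mul_def] at p11 p12 p22 p33 p13 p32
  have s1 := p11.const_mul (coefA P X α ^ 2)
  have s2 := s1.fun_add (p12.const_mul (2 * coefA P X α * coefA P X (1 - α)))
  have s3 := s2.fun_add (p22.const_mul (coefA P X (1 - α) ^ 2))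
  have s4 := s3.fun_add (p33.const_mul (4 * (expectile P X (1 - α) - expectile P X α) ^ 2))
  have s5 := s4.fun_add
    (p13.const_mul (-4 * (expectile P X (1 - α) - expectile P X α) * coefA P X α))
  have h : ∫ ω, influence P X α (X ω) ^ 2 ∂P =
      (2 / ((1 - 2 * α) * (expectile P X (1 - α) - expectile P X α) ^ 2)) ^ 2 *
      (coefA P X α ^ 2 * eta P X α α +
        2 * coefA P X α * coefA P X (1 - α) * eta P X α (1 - α) +
        coefA P X (1 - α) ^ 2 * eta P X (1 - α) (1 - α) +
        4 * (expectile P X (1 - α) - expectile P X α) ^ 2 * eta P X (1 / 2) (1 / 2) +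
        (-4 * (expectile P X (1 - α) - expectile P X α) * coefA P X α) * eta P X α (1 / 2) +
        (-4 * (expectile P X (1 - α) - expectile P X α) * coefA P X (1 - α)) *
          eta P X (1 / 2) (1 - α)) := by
    rw [integral_congr_ae (ae_of_all _ e), integral_const_mul]
    congr 1
    rw [integral_add s5 (p32.const_mul _), integral_add s4 (p13.const_mul _),
      integral_add s3 (p33.const_mul _), integral_add s2 (p22.const_mul _),
      integral_add s1 (p12.const_mul _)]
    simp only [integral_const_mul, eta]
  rw [h, asympVar]
  field_simp
  ring

end Population

/-! ### Asymptotic linearity of the empirical skewness -/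

section Sequence

variable {Ω : Type*} [MeasurableSpace Ω] {P : Measure Ω} [IsProbabilityMeasure P]
  {X : Ω → ℝ} {Xs : ℕ → Ω → ℝ}

theorem ae_tendsto_avg_ident (hindep : iIndepFun Xs P) (hident : ∀ i, IdentDistrib (Xs i) X P P)
    (hX : Integrable X P) {τ : ℝ} (h0 : 0 < τ) (h1 : τ < 1) :
    ∀ᵐ ω ∂P, Tendsto (avg (ident τ (expectile P X τ)) fun i => Xs i ω) atTop (𝓝 0) := by
  have h := ae_tendsto_avg hindep hident (measurable_ident τ (expectile P X τ))
    (integrable_ident hX τ _)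
  rwa [integral_ident_expectile hX h0 h1] at h

/-- The strong law supplies the hypotheses of `isLittleO_empExpectile` almost surely. -/
theorem ae_isLittleO_empExpectile (hindep : iIndepFun Xs P)
    (hident : ∀ i, IdentDistrib (Xs i) X P P) (hX : Integrable X P) {τ : ℝ} (h0 : 0 < τ)
    (h1 : τ < 1) (hatom : (P.map X) {expectile P X τ} = 0) :
    ∀ᵐ ω ∂P, (fun n : ℕ => empExpectile (fun i : Fin n => Xs i ω) τ - expectile P X τ -
      avg (ident τ (expectile P X τ)) (fun i => Xs i ω) n /
        (τ + cdf (P.map X) (expectile P X τ) * (1 - 2 * τ))) =o[atTop]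
      avg (ident τ (expectile P X τ)) fun i => Xs i ω := by
  have := Measure.isProbabilityMeasure_map (μ := P) hX.aemeasurable
  have hF := ae_tendsto_avg_indicator hindep hident (measurableSet_Iic (a := expectile P X τ))
  rw [← cdf_eq_real (P.map X) (expectile P X τ)] at hF
  have hI := ae_tendsto_avg_ident hindep hident hX h0 h1
  have hB := ae_eventually_avg_closedBall_le hindep hident hatom
  filter_upwards [hI, hF, hB] with ω a1 a2 a3
  have c0 := cdf_nonneg (P.map X) (expectile P X τ)
  have c1 := cdf_le_one (P.map X) (expectile P X τ)
  exact isLittleO_empExpectile (x := fun i => Xs i ω) h0 h1 c0 c1 a1 a2 a3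

/-- The size of the three empirical means through which the empirical expectile skewness deviates
from its population value. -/
noncomputable def meanSize (P : Measure Ω) (X : Ω → ℝ) (α : ℝ) (x : ℕ → ℝ) (n : ℕ) : ℝ :=
  |avg (ident α (expectile P X α)) x n| + |avg (ident (1 - α) (expectile P X (1 - α))) x n| +
    |avg (ident (1 / 2) (expectile P X (1 / 2))) x n|

omit [IsProbabilityMeasure P] in
theorem sq_sqrt_mul_meanSize_le (P : Measure Ω) (X : Ω → ℝ) (α : ℝ) (x : ℕ → ℝ) (n : ℕ) :
    (√n * meanSize P X α x n) ^ 2 ≤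
      3 * ((√n * avg (ident α (expectile P X α)) x n) ^ 2 +
        (√n * avg (ident (1 - α) (expectile P X (1 - α))) x n) ^ 2 +
        (√n * avg (ident (1 / 2) (expectile P X (1 / 2))) x n) ^ 2) := by
  have hq : ∀ u v w : ℝ, (|u| + |v| + |w|) ^ 2 ≤ 3 * (u ^ 2 + v ^ 2 + w ^ 2) := fun u v w => by
    rw [← sq_abs u, ← sq_abs v, ← sq_abs w]
    nlinarith [sq_nonneg (|u| - |v|), sq_nonneg (|u| - |w|), sq_nonneg (|v| - |w|)]
  rw [mul_pow, mul_pow, mul_pow, mul_pow, ← mul_add, ← mul_add, mul_left_comm]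
  exact mul_le_mul_of_nonneg_left (hq _ _ _) (sq_nonneg _)

/-- Almost surely the empirical expectile skewness is asymptotically linear, with the influence
function as its linear part. -/
theorem ae_isLittleO_empSkew (hindep : iIndepFun Xs P)
    (hident : ∀ i, IdentDistrib (Xs i) X P P) (hX : Integrable X P) {α : ℝ} (h0 : 0 < α)
    (h1 : α < 1 / 2) (hatom : (P.map X) {expectile P X α} = 0)
    (hatom' : (P.map X) {expectile P X (1 - α)} = 0) :
    ∀ᵐ ω ∂P, (fun n : ℕ => empSkew (fun i : Fin n => Xs i ω) α - skew P X α -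
      avg (influence P X α) (fun i => Xs i ω) n) =o[atTop] meanSize P X α fun i => Xs i ω := by
  have hlt := expectile_lt_expectile hX h0 h1 hatom
  filter_upwards [ae_isLittleO_empExpectile hindep hident hX h0 (by linarith) hatom,
    ae_isLittleO_empExpectile hindep hident hX (by linarith) (by linarith) hatom',
    ae_tendsto_avg_ident hindep hident hX h0 (by linarith),
    ae_tendsto_avg_ident hindep hident hX (τ := 1 - α) (by linarith) (by linarith),
    ae_tendsto_avg_ident hindep hident hX (τ := 1 / 2) (by norm_num) (by norm_num)]
    with ω lb la tb ta tm
  set x : ℕ → ℝ := fun i => Xs i ω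
  have hg : Tendsto (meanSize P X α x) atTop (𝓝 0) := by
    have := (tb.abs.add ta.abs).add tm.abs
    rwa [abs_zero, add_zero, add_zero] at this
  have bound : ∀ {f : ℕ → ℝ}, (∀ n, |f n| ≤ meanSize P X α x n) → f =O[atTop] meanSize P X α x :=
    fun hf => Asymptotics.IsBigO.of_bound 1 (Eventually.of_forall fun n => by
      rw [one_mul]
      exact (hf n).trans (le_abs_self _))
  have Ob : avg (ident α (expectile P X α)) x =O[atTop] meanSize P X α x := bound fun n =>
    (le_add_of_nonneg_right (abs_nonneg _)).trans (le_add_of_nonneg_right (abs_nonneg _))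
  have Oa : avg (ident (1 - α) (expectile P X (1 - α))) x =O[atTop] meanSize P X α x :=
    bound fun n =>
      (le_add_of_nonneg_left (abs_nonneg _)).trans (le_add_of_nonneg_right (abs_nonneg _))
  have Om : avg (ident (1 / 2) (expectile P X (1 / 2))) x =O[atTop] meanSize P X α x :=
    bound fun n => le_add_of_nonneg_left (by positivity)
  -- the sample mean is exactly linear in the centred observations
  have lm : (fun n : ℕ => 1 / (n : ℝ) * ∑ i : Fin n, x i - ∫ ω, X ω ∂P -
      2 * avg (ident (1 / 2) (expectile P X (1 / 2))) x n) =o[atTop] meanSize P X α x := by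
    refine (Asymptotics.isLittleO_zero _ _).congr' ?_ EventuallyEq.rfl
    filter_upwards [eventually_ne_atTop 0] with n hn
    have e : avg (ident (1 / 2) (expectile P X (1 / 2))) x n =
        1 / 2 * (avg (fun y => y) x n - ∫ ω, X ω ∂P) := by
      have hc := avg_sub (fun y => y) (fun _ => ∫ ω, X ω ∂P) x n
      rw [avg_const _ x hn] at hc
      rw [← hc, ← avg_const_mul, expectile_one_half hX]
      congr 1 with y
      rw [ident_one_half]
      ring
    rw [e, avg]
    ring
  have key := isLittleO_skewness_quotient hlt (la.trans_isBigO Oa) (lb.trans_isBigO Ob) lm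
    ((Oa.const_mul_left ((1 - α) + cdf (P.map X) (expectile P X (1 - α)) *
      (1 - 2 * (1 - α)))⁻¹).congr_left fun n => (div_eq_inv_mul _ _).symm)
    ((Ob.const_mul_left (α + cdf (P.map X) (expectile P X α) *
      (1 - 2 * α))⁻¹).congr_left fun n => (div_eq_inv_mul _ _).symm)
    (Om.const_mul_left 2) hg
  refine (key.const_mul_left (1 / (1 - 2 * α))).congr_left fun n => ?_
  have hA : coefA P X α = (expectile P X (1 - α) - ∫ ω, X ω ∂P) /
      (α + cdf (P.map X) (expectile P X α) * (1 - 2 * α)) := by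
    rw [coefA, if_pos h1]
    ring
  have hA' : coefA P X (1 - α) = (∫ ω, X ω ∂P - expectile P X α) /
      ((1 - α) + cdf (P.map X) (expectile P X (1 - α)) * (1 - 2 * (1 - α))) := by
    rw [coefA, if_neg (by linarith), sub_sub_cancel]
    ring
  unfold influence
  rw [avg_const_mul, avg_sub, avg_add, avg_const_mul, avg_const_mul, avg_const_mul, hA, hA',
    empSkew, skew, ← div_div]
  ring

end Sequence

end ExpectileSkewness

theorem mainTheorem4 {Ω : Type*} [MeasurableSpace Ω] (P : Measure Ω) [IsProbabilityMeasure P]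
    (X : Ω → ℝ) (Xs : ℕ → Ω → ℝ)
    (hindep : iIndepFun Xs P) (hident : ∀ i, IdentDistrib (Xs i) X P P)
    (hX : MemLp X 2 P)
    (α : ℝ) (hα0 : 0 < α) (hα : α < 1 / 2)
    (hatom : ∀ p ∈ ({α, 1 / 2, 1 - α} : Set ℝ),
      (P.map X) {ExpectileSkewness.expectile P X p} = 0) :
    0 ≤ ExpectileSkewness.asympVar P X α ∧
      TendstoInDistribution
        (fun (n : ℕ) (ω : Ω) => Real.sqrt n *
          (ExpectileSkewness.empSkew (fun i : Fin n => Xs i ω) α - ExpectileSkewness.skew P X α))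
        atTop id (fun _ => P)
        (gaussianReal 0 (ExpectileSkewness.asympVar P X α).toNNReal) := by
  open ExpectileSkewness in
  have hXi : Integrable X P := hX.integrable one_le_two
  have hb := hatom α (by simp)
  have ha := hatom (1 - α) (by simp)
  have hlt := expectile_lt_expectile hXi hα0 hα hb
  have hvar := asympVar_eq_variance hX hα0 hα hlt
  refine ⟨hvar ▸ variance_nonneg _ _, ?_⟩
  have hclt := tendstoInDistribution_sqrt_mul_avg hindep hident (measurable_influence P X α)
    (memLp_influence hX hα0 hα) (integral_influence hX hα0 hα)
  rw [← hvar] at hclt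
  have hmeas : ∀ n : ℕ, AEMeasurable (fun ω => √n *
      (empSkew (fun i : Fin n => Xs i ω) α - skew P X α)) P := fun n => by
    have hXs : AEMeasurable (fun ω i => Xs i ω) P :=
      aemeasurable_pi_lambda _ fun i => (hident i).aemeasurable_fst
    have e1 := (measurable_empExpectile (τ := 1 - α) (by linarith) (by linarith)
      n).comp_aemeasurable hXs
    have e2 := (measurable_empExpectile hα0 (by linarith) n).comp_aemeasurable hXs
    have e3 := aemeasurable_avg hident measurable_id n
    exact ((((e1.add e2).sub (e3.const_mul 2)).div (e1.sub e2)).const_mul _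
      |>.sub_const _).const_mul _
  have hparts : ∀ τ : ℝ, 0 < τ → τ < 1 → ∀ n : ℕ, _ := fun τ h0 h1 n =>
    integral_sq_sqrt_mul_avg_le hindep hident (measurable_ident τ (expectile P X τ))
      (memLp_ident hX h0 h1 _) (integral_ident_expectile hXi h0 h1) n
  have hVm : ∀ n : ℕ, AEMeasurable (fun ω => √n * meanSize P X α (fun i => Xs i ω) n) P := fun n =>
    (((aemeasurable_avg hident (measurable_ident _ _) n).abs.add
      (aemeasurable_avg hident (measurable_ident _ _) n).abs).add
      (aemeasurable_avg hident (measurable_ident _ _) n).abs).const_mul _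
  have hVle := fun (n : ℕ) (ω : Ω) => sq_sqrt_mul_meanSize_le P X α (fun i => Xs i ω) n
  have q1 := hparts α hα0 (by linarith)
  have q2 := hparts (1 - α) (by linarith) (by linarith)
  have q3 := hparts (1 / 2) (by norm_num) (by norm_num)
  have hSi := fun n => (((q1 n).1.fun_add (q2 n).1).fun_add (q3 n).1).const_mul 3
  have hVi : ∀ n : ℕ, Integrable (fun ω => (√n * meanSize P X α (fun i => Xs i ω) n) ^ 2) P :=
    fun n => (hSi n).mono' ((hVm n).pow_const 2).aestronglyMeasurable
      (ae_of_all _ fun ω => by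
        rw [Real.norm_eq_abs, abs_of_nonneg (sq_nonneg _)]
        exact hVle n ω)
  -- Slutsky: it remains to see that the linearization error vanishes in probability
  refine tendstoInDistribution_of_tendstoInMeasure_sub _ _ hclt ?_ hmeas
  refine tendstoInMeasure_zero_of_isLittleO
    (V := fun n ω => √n * meanSize P X α (fun i => Xs i ω) n)
    (C := 3 * (Var[fun ω => ident α (expectile P X α) (X ω); P] +
      Var[fun ω => ident (1 - α) (expectile P X (1 - α)) (X ω); P] +
      Var[fun ω => ident (1 / 2) (expectile P X (1 / 2)) (X ω); P]))
    (fun n => (hmeas n).sub (hclt.forall_aemeasurable n)) hVm hVi (fun n => ?_) ?_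
  · refine (integral_mono (hVi n) (hSi n) (hVle n)).trans ?_
    rw [integral_const_mul, integral_add ((q1 n).1.fun_add (q2 n).1) (q3 n).1,
      integral_add (q1 n).1 (q2 n).1]
    linarith [(q1 n).2, (q2 n).2, (q3 n).2]
  · filter_upwards [ae_isLittleO_empSkew hindep hident hXi hα0 hα hb ha] with ω hω
    refine ((Asymptotics.isBigO_refl (fun n : ℕ => √(n : ℝ)) atTop).mul_isLittleO hω).congr_left
      fun n => ?_
    simp only [Pi.sub_apply]
    ring
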